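/- For $0<p<\infty$ and a real matrix $X\in\mathbb{R}^{m\times n}$, let $\|X\|_{S_p}=\big(\sum_i\sigma_i(X)^p\big)^{1/p}$ denote its Schatten-$p$ norm (a quasi-norm if $p<1$), where $\sigma_i(X)$ are the singular values of $X$. Let $X\in\mathbb{R}^{m\times n}$ have rank $r\le d$, and let $0<p\le 1$, $p_1>0$ and $p_2>0$ satisfy $1/p_1+1/p_2=1/p$. Then $$\|X\|_{S_p}=\min_{U,V}\ \|U\|_{S_{p_1}}\|V\|_{S_{p_2}}=\min_{U,V}\left(\frac{p_2\|U\|_{S_{p_1}}^{p_1}+p_1\|V\|_{S_{p_2}}^{p_2}}{p_1+p_2}\right)^{1/p}=\min_{U,V}\left(\frac{\|U\|_{S_{p_1}}^{p_1}/p_1+\|V\|_{S_{p_2}}^{p_2}/p_2}{1/p}\right)^{1/p},$$ where each minimum is taken over all $U\in\mathbb{R}^{m\times d}$ and $V\in\mathbb{R}^{n\times d}$ with $X=UV^{T}$, and is attained. -/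

import Mathlib

/-- The `i`-th singular value (indexed from `0`, in decreasing order, with multiplicity) of a real
matrix `X`, seen as a linear map between Euclidean spaces. -/
noncomputable def singularValue {m n : ℕ} (X : Matrix (Fin m) (Fin n) ℝ) (i : ℕ) : ℝ :=
  (Matrix.toEuclideanLin X).singularValues i

/-- The Schatten-`p` norm (`1 ≤ p < ∞`) or quasi-norm (`0 < p < 1`) of a real `m × n` matrix `X`:
`(∑ᵢ σᵢ(X) ^ p) ^ (1 / p)`. The sum has one term for each of the `n` columns; if `m < n`, the
singular values of index at least `m` are zero, and so are their `p`-th powers. -/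
noncomputable def schattenNorm {m n : ℕ} (p : ℝ) (X : Matrix (Fin m) (Fin n) ℝ) : ℝ :=
  (∑ i ∈ Finset.range n, singularValue X i ^ p) ^ (1 / p)

/-!
The lower bound is Hölder's inequality for Schatten quasi-norms,
`‖U Vᵀ‖_p ≤ ‖U‖_{p₁} ‖V‖_{p₂}` (`schattenNorm_mul_transpose_le`). It comes from Horn's inequality
`∏_{i<k} σᵢ(U Vᵀ) ≤ ∏_{i<k} σᵢ(U) σᵢ(V)` (`prod_singularValue_mul_le`): such a domination of all
initial products by those of another sequence gives domination of the sums of `p`-th powers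
(`sum_rpow_le_sum_rpow_of_prod_le`), and the scalar Hölder inequality finishes.

Horn's inequality rests on one determinant bound, `det_gram_mul_le`: for every `W` with `k` columns,
`det ((X W)ᵀ (X W)) ≤ (∏_{i<k} σᵢ(X))² det (Wᵀ W)`. After diagonalizing `Xᵀ X` this compares two
Cauchy–Binet expansions term by term. Taking for `W` the leading right singular vectors of `U Vᵀ`
and applying the bound to `U` and then to `Vᵀ` gives Horn's inequality with `σᵢ(Vᵀ)` in place of
`σᵢ(V)`; the same bound, applied to `V` and `Vᵀ W'` with `W'` the leading left singular vectors
of `V`, shows `∏_{i<k} σᵢ(Vᵀ) ≤ ∏_{i<k} σᵢ(V)`.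

The two weighted means coincide, and they dominate `‖U‖_{p₁} ‖V‖_{p₂}` by the weighted inequality
of arithmetic and geometric means (`mul_le_weighted_mean_rpow`). All three minima are attained at
one factorization (`exists_balanced_factorization`), which distributes the powers `σᵢ ^ (p / p₁)`
and `σᵢ ^ (p / p₂)` of the singular values of `X` over the two factors.
-/

open Matrix Finset

/-! ### Inequalities for real sequences -/

theorem div_add_div_eq_one_of_one_div_add {p p₁ p₂ : ℝ} (hp : 0 < p) (hp₁ : 0 < p₁) (hp₂ : 0 < p₂)
    (hsum : 1 / p₁ + 1 / p₂ = 1 / p) : p / p₁ + p / p₂ = 1 := by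
  field_simp at hsum ⊢
  linarith

/-- If the partial sums of `δ` are nonnegative, so are those of `c * δ` for antitone nonnegative
weights `c`, by summation by parts. -/
theorem sum_mul_nonneg_of_antitone {c δ : ℕ → ℝ} (hc : Antitone c) (hc0 : ∀ i, 0 ≤ c i)
    {n : ℕ} (h : ∀ k ≤ n, 0 ≤ ∑ i ∈ range k, δ i) : 0 ≤ ∑ i ∈ range n, c i * δ i := by
  -- bounding below by `c k` times the partial sum makes the induction go through
  have key : ∀ k ≤ n, c k * ∑ i ∈ range k, δ i ≤ ∑ i ∈ range k, c i * δ i := by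
    intro k
    induction k with
    | zero => simp
    | succ k ih =>
      intro hk
      have h1 := ih (by omega)
      have h2 : c (k + 1) * ∑ i ∈ range (k + 1), δ i ≤ c k * ∑ i ∈ range (k + 1), δ i :=
        mul_le_mul_of_nonneg_right (hc k.le_succ) (h _ hk)
      rw [sum_range_succ] at h2 ⊢
      rw [sum_range_succ]
      linarith
  exact (mul_nonneg (hc0 n) (h n le_rfl)).trans (key n le_rfl)

/-- Weak log-majorization implies weak majorization of `p`-th powers. Only `a` has to be
antitone. -/
theorem sum_rpow_le_sum_rpow_of_prod_le {a b : ℕ → ℝ} (ha : Antitone a) (ha0 : ∀ i, 0 ≤ a i)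
    (hb0 : ∀ i, 0 ≤ b i) {p : ℝ} (hp : 0 < p) {n : ℕ}
    (h : ∀ k ≤ n, ∏ i ∈ range k, a i ≤ ∏ i ∈ range k, b i) :
    ∑ i ∈ range n, a i ^ p ≤ ∑ i ∈ range n, b i ^ p := by
  induction n with
  | zero => simp
  | succ n ih =>
    rcases (ha0 n).eq_or_lt with hn | hn
    · rw [sum_range_succ, sum_range_succ, ← hn, Real.zero_rpow hp.ne']
      exact add_le_add (ih fun k hk => h k (by omega)) (Real.rpow_nonneg (hb0 n) p)
    · have hapos : ∀ i < n + 1, 0 < a i := fun i hi => hn.trans_le (ha (by omega))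
      have hbpos : ∀ i < n + 1, 0 < b i := by
        intro i hi
        have h1 : 0 < ∏ i ∈ range (n + 1), b i :=
          (prod_pos fun i hi => hapos i (mem_range.1 hi)).trans_le (h _ le_rfl)
        exact (hb0 i).lt_of_ne' (prod_ne_zero_iff.1 h1.ne' i (mem_range.2 hi))
      have hsum : 0 ≤ ∑ i ∈ range (n + 1), a i ^ p * (Real.log (b i) - Real.log (a i)) := by
        refine sum_mul_nonneg_of_antitone
          (fun i j hij => Real.rpow_le_rpow (ha0 j) (ha hij) hp.le)
          (fun i => Real.rpow_nonneg (ha0 i) p) fun k hk => ?_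
        rw [sum_sub_distrib, sub_nonneg,
          ← Real.log_prod fun i hi => (hapos i (by have := mem_range.1 hi; omega)).ne',
          ← Real.log_prod fun i hi => (hbpos i (by have := mem_range.1 hi; omega)).ne']
        exact Real.log_le_log
          (prod_pos fun i hi => hapos i (by have := mem_range.1 hi; omega)) (h k hk)
      -- the tangent line inequality for `x ↦ exp (p * x)` at `x = log (a i)`
      have hterm : ∀ i ∈ range (n + 1),
          a i ^ p + p * (a i ^ p * (Real.log (b i) - Real.log (a i))) ≤ b i ^ p := by
        intro i hi
        have hai := hapos i (mem_range.1 hi)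
        have hbi := hbpos i (mem_range.1 hi)
        have h1 : b i ^ p = a i ^ p * Real.exp (p * (Real.log (b i) - Real.log (a i))) := by
          rw [Real.rpow_def_of_pos hai, Real.rpow_def_of_pos hbi, ← Real.exp_add]
          ring_nf
        have h2 := mul_le_mul_of_nonneg_left
          (Real.add_one_le_exp (p * (Real.log (b i) - Real.log (a i))))
          (Real.rpow_nonneg hai.le p)
        rw [h1]
        linarith
      have h3 := sum_le_sum hterm
      rw [sum_add_distrib, ← mul_sum] at h3
      nlinarith [mul_nonneg hp.le hsum]

/-- Hölder's inequality for three exponents, `1 / p₁ + 1 / p₂ = 1 / p`, without roots. -/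
theorem sum_mul_rpow_le {s t : ℕ → ℝ} (hs : ∀ i, 0 ≤ s i) (ht : ∀ i, 0 ≤ t i) {p p₁ p₂ : ℝ}
    (hp : 0 < p) (hp₁ : 0 < p₁) (hp₂ : 0 < p₂) (hsum : 1 / p₁ + 1 / p₂ = 1 / p) (I : Finset ℕ) :
    ∑ i ∈ I, (s i * t i) ^ p ≤ (∑ i ∈ I, s i ^ p₁) ^ (p / p₁) * (∑ i ∈ I, t i ^ p₂) ^ (p / p₂) := by
  have hpq : (p₁ / p).HolderConjugate (p₂ / p) :=
    (Real.HolderTriple.mk (by simpa using hsum) hp₁ hp₂).holderConjugate_div_div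
  have := Real.inner_le_Lp_mul_Lq_of_nonneg I hpq
    (f := fun i => s i ^ p) (g := fun i => t i ^ p)
    (fun i _ => Real.rpow_nonneg (hs i) p) (fun i _ => Real.rpow_nonneg (ht i) p)
  simpa only [← Real.mul_rpow (hs _) (ht _), ← Real.rpow_mul (hs _), ← Real.rpow_mul (ht _),
    mul_div_cancel₀ _ hp.ne', one_div_div] using this

/-- The weighted arithmetic-geometric mean inequality for `a ^ p₁` and `b ^ p₂` with weights
`p / p₁` and `p / p₂`. -/
theorem mul_le_weighted_mean_rpow {a b p p₁ p₂ : ℝ} (ha : 0 ≤ a) (hb : 0 ≤ b) (hp : 0 < p)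
    (hp₁ : 0 < p₁) (hp₂ : 0 < p₂) (hsum : 1 / p₁ + 1 / p₂ = 1 / p) :
    a * b ≤ ((a ^ p₁ / p₁ + b ^ p₂ / p₂) / (1 / p)) ^ (1 / p) := by
  have hsum' := div_add_div_eq_one_of_one_div_add hp hp₁ hp₂ hsum
  have h := Real.geom_mean_le_arith_mean2_weighted (div_pos hp hp₁).le (div_pos hp hp₂).le
    (Real.rpow_nonneg ha p₁) (Real.rpow_nonneg hb p₂) hsum'
  rw [← Real.rpow_mul ha, ← Real.rpow_mul hb, mul_div_cancel₀ p hp₁.ne', mul_div_cancel₀ p hp₂.ne',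
    ← Real.mul_rpow ha hb] at h
  have h' := Real.rpow_le_rpow (Real.rpow_nonneg (mul_nonneg ha hb) p) h (one_div_pos.2 hp).le
  rw [← Real.rpow_mul (mul_nonneg ha hb), mul_one_div_cancel hp.ne', Real.rpow_one] at h'
  refine h'.trans_eq (congrArg (· ^ (1 / p)) ?_)
  field_simp

theorem prod_le_prod_range_card {s : ℕ → ℝ} (hs : Antitone s) (hs0 : ∀ i, 0 ≤ s i)
    (I : Finset ℕ) : ∏ i ∈ I, s i ≤ ∏ i ∈ range #I, s i := by
  refine Finset.induction_on_max I (by simp) fun a I hI ih => ?_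
  have ha : a ∉ I := fun h => (hI a h).false
  have hcard : #I ≤ a := by
    simpa using card_le_card (fun x hx => mem_range.2 (hI x hx) : I ⊆ range a)
  rw [prod_insert ha, card_insert_of_notMem ha, prod_range_succ, mul_comm]
  exact mul_le_mul ih (hs hcard) (hs0 a) (prod_nonneg fun i _ => hs0 i)

/-! ### A determinant bound of Cauchy–Binet type -/

/-- A Cauchy–Binet formula. The sum runs over all maps `f`, each selecting a `k × k` minor; every
set of `k` rows is counted `k!` times, and the non-injective `f` contribute zero. -/
theorem factorial_mul_det_transpose_mul_diagonal_mul {n k : ℕ} (s : Fin n → ℝ)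
    (W : Matrix (Fin n) (Fin k) ℝ) :
    (k.factorial : ℝ) * (Wᵀ * diagonal s * W).det =
      ∑ f : Fin k → Fin n, (∏ i, s (f i)) * (W.submatrix f id).det ^ 2 := by
  have hexp : (Wᵀ * diagonal s * W).det =
      ∑ f : Fin k → Fin n, (∏ i, W (f i) i * s (f i)) * (W.submatrix f id).det := by
    have hrow : Wᵀ * diagonal s * W = fun i => ∑ l, (W l i * s l) • W l := by
      ext i j
      rw [Matrix.mul_apply]
      simp [mul_diagonal, Finset.sum_apply]
    have h := (detRowAlternating (R := ℝ) (n := Fin k)).toMultilinearMap.map_sum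
      (fun i l => (W l i * s l) • W l)
    rw [hrow]
    refine h.trans (sum_congr rfl fun f _ => ?_)
    exact (detRowAlternating (R := ℝ) (n := Fin k)).toMultilinearMap.map_smul_univ
      (fun i => W (f i) i * s (f i)) (fun i => W (f i))
  -- reindexing by `f ↦ f ∘ σ` permutes the rows of the minor; averaging over `σ` then turns
  -- the product of diagonal entries into a second copy of the minor
  have hperm : ∀ σ : Equiv.Perm (Fin k), (Wᵀ * diagonal s * W).det =
      ∑ f : Fin k → Fin n, (∏ i, s (f i)) * (W.submatrix f id).det *
        ((Equiv.Perm.sign σ : ℤ) * ∏ i, W.submatrix f id (σ i) i) := by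
    intro σ
    rw [hexp, ← (σ.symm.arrowCongr (Equiv.refl (Fin n))).sum_comp]
    refine sum_congr rfl fun f _ => ?_
    have hdet : (W.submatrix (f ∘ σ) id).det =
        (Equiv.Perm.sign σ : ℤ) * (W.submatrix f id).det :=
      det_permute σ (W.submatrix f id)
    have hs : ∏ i, s (f (σ i)) = ∏ i, s (f i) := Equiv.prod_comp σ fun i => s (f i)
    have he : (σ.symm.arrowCongr (Equiv.refl (Fin n))) f = f ∘ σ := by
      ext i; simp
    rw [he, hdet, prod_mul_distrib]
    simp only [Function.comp_apply, hs, submatrix_apply, id]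
    ring
  calc (k.factorial : ℝ) * (Wᵀ * diagonal s * W).det
      = ∑ _σ : Equiv.Perm (Fin k), (Wᵀ * diagonal s * W).det := by
        simp [Fintype.card_perm]
    _ = _ := by
        rw [sum_congr rfl fun σ _ => hperm σ, sum_comm]
        refine sum_congr rfl fun f _ => ?_
        rw [← mul_sum, ← det_apply', sq, mul_assoc]

theorem det_transpose_mul_diagonal_mul_le {n k : ℕ} {s : ℕ → ℝ} (hs : Antitone s)
    (hs0 : ∀ i, 0 ≤ s i) (W : Matrix (Fin n) (Fin k) ℝ) :
    (Wᵀ * diagonal (fun i : Fin n => s i) * W).det ≤ (∏ i ∈ range k, s i) * (Wᵀ * W).det := by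
  have hk : (0 : ℝ) < k.factorial := by exact_mod_cast k.factorial_pos
  refine le_of_mul_le_mul_left ?_ hk
  have h1 := factorial_mul_det_transpose_mul_diagonal_mul (fun _ => 1) W
  rw [diagonal_one, Matrix.mul_one] at h1
  rw [mul_left_comm, h1, factorial_mul_det_transpose_mul_diagonal_mul, mul_sum]
  refine sum_le_sum fun f _ => ?_
  simp only [prod_const_one, one_mul]
  by_cases hf : Function.Injective f
  · refine mul_le_mul_of_nonneg_right ?_ (sq_nonneg _)
    have hinj : Function.Injective fun i : Fin k => (f i : ℕ) := Fin.val_injective.comp hf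
    have := prod_le_prod_range_card hs hs0 (univ.map ⟨_, hinj⟩)
    simpa using this
  · obtain ⟨i, j, hij, hne⟩ : ∃ i j, f i = f j ∧ i ≠ j := by
      simpa [Function.Injective] using hf
    have : (W.submatrix f id).det = 0 :=
      det_zero_of_row_eq hne (by ext l; simp [hij])
    simp [this]

/-! ### Singular values and Gram matrices -/

theorem singularValue_nonneg {m n : ℕ} (X : Matrix (Fin m) (Fin n) ℝ) (i : ℕ) :
    0 ≤ singularValue X i :=
  LinearMap.singularValues_nonneg _ i

theorem singularValue_antitone {m n : ℕ} (X : Matrix (Fin m) (Fin n) ℝ) :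
    Antitone (singularValue X) :=
  LinearMap.singularValues_antitone _

theorem singularValue_eq_zero_of_le {m n : ℕ} (X : Matrix (Fin m) (Fin n) ℝ) {i : ℕ}
    (hi : n ≤ i) : singularValue X i = 0 :=
  LinearMap.singularValues_of_finrank_le _ (by simpa using hi)

theorem singularValue_eq_zero_of_rank_le {m n : ℕ} (X : Matrix (Fin m) (Fin n) ℝ) {i : ℕ}
    (hi : X.rank ≤ i) : singularValue X i = 0 := by
  refine (LinearMap.singularValues_eq_zero_iff_le_finrank_range _).2 (le_of_eq_of_le ?_ hi)
  exact (X.rank_eq_finrank_range_toLin (EuclideanSpace.basisFun _ ℝ).toBasis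
    (EuclideanSpace.basisFun _ ℝ).toBasis).symm

/-- Spectral decomposition of the Gram matrix `Xᵀ X`: the columns of `Q` are right singular vectors
of `X`, in the order of `singularValue X`. -/
theorem exists_gram_eq_mul_diagonal_mul {m n : ℕ} (X : Matrix (Fin m) (Fin n) ℝ) :
    ∃ Q : Matrix (Fin n) (Fin n) ℝ, Qᵀ * Q = 1 ∧ Q * Qᵀ = 1 ∧
      Xᵀ * X = Q * diagonal (fun i : Fin n => singularValue X i ^ 2) * Qᵀ := by
  set T := Matrix.toEuclideanLin X with hT
  have hn : Module.finrank ℝ (EuclideanSpace ℝ (Fin n)) = n := finrank_euclideanSpace_fin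
  set b := T.isSymmetric_adjoint_comp_self.eigenvectorBasis hn with hb
  let Q : Matrix (Fin n) (Fin n) ℝ := Matrix.of fun i j => b j i
  have hQ : Qᵀ * Q = 1 := by
    ext i j
    have h := orthonormal_iff_ite.1 b.orthonormal i j
    rw [EuclideanSpace.inner_eq_star_dotProduct] at h
    rw [Matrix.one_apply, ← h, Matrix.mul_apply, dotProduct]
    exact sum_congr rfl fun x _ => mul_comm _ _
  have hQ' : Q * Qᵀ = 1 := mul_eq_one_comm.1 hQ
  refine ⟨Q, hQ, hQ', ?_⟩
  have hcol : Xᵀ * X * Q = Q * diagonal (fun i : Fin n => singularValue X i ^ 2) := by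
    ext i j
    have h := T.isSymmetric_adjoint_comp_self.apply_eigenvectorBasis hn j
    rw [← T.sq_singularValues_fin hn j, ← hb, LinearMap.comp_apply, hT,
      ← Matrix.toEuclideanLin_conjTranspose_eq_adjoint] at h
    have h' := congrFun (congrArg WithLp.ofLp h) i
    simp only [Matrix.toLpLin_apply, Matrix.conjTranspose_eq_transpose_of_trivial,
      Matrix.mulVec_mulVec] at h'
    rw [mul_diagonal, Matrix.mul_apply]
    refine h'.trans ?_
    simp [Q, singularValue, mul_comm]
  rw [← hcol, Matrix.mul_assoc, hQ', Matrix.mul_one]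

/-- The map `X` scales squared `k`-dimensional volumes by at most the square of the product of its
`k` largest singular values. -/
theorem det_gram_mul_le {m n k : ℕ} (X : Matrix (Fin m) (Fin n) ℝ)
    (W : Matrix (Fin n) (Fin k) ℝ) :
    ((X * W)ᵀ * (X * W)).det ≤ (∏ i ∈ range k, singularValue X i) ^ 2 * (Wᵀ * W).det := by
  obtain ⟨Q, -, hQ, hX⟩ := exists_gram_eq_mul_diagonal_mul X
  have h := det_transpose_mul_diagonal_mul_le (s := fun i => singularValue X i ^ 2)
    (fun i j hij => pow_le_pow_left₀ (singularValue_nonneg X j) (singularValue_antitone X hij) 2)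
    (fun i => sq_nonneg _) (Qᵀ * W)
  have h1 : (X * W)ᵀ * (X * W) =
      (Qᵀ * W)ᵀ * diagonal (fun i : Fin n => singularValue X i ^ 2) * (Qᵀ * W) := by
    calc (X * W)ᵀ * (X * W) = Wᵀ * (Xᵀ * X) * W := by
          simp only [Matrix.transpose_mul, Matrix.mul_assoc]
      _ = _ := by
          rw [hX]
          simp only [Matrix.transpose_mul, Matrix.transpose_transpose, Matrix.mul_assoc]
  have h2 : (Qᵀ * W)ᵀ * (Qᵀ * W) = Wᵀ * W := by
    rw [Matrix.transpose_mul, Matrix.transpose_transpose, Matrix.mul_assoc, ← Matrix.mul_assoc Q,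
      hQ, Matrix.one_mul]
  rwa [← h1, h2, prod_pow] at h

/-- The columns of `W` are the `k` leading right singular vectors of `X`. -/
theorem exists_gram_mul_eq_diagonal {m n k : ℕ} (X : Matrix (Fin m) (Fin n) ℝ) (hk : k ≤ n) :
    ∃ W : Matrix (Fin n) (Fin k) ℝ, Wᵀ * W = 1 ∧
      Wᵀ * (Xᵀ * X) = diagonal (fun i : Fin k => singularValue X i ^ 2) * Wᵀ := by
  obtain ⟨Q, hQ, -, hX⟩ := exists_gram_eq_mul_diagonal_mul X
  refine ⟨Q.submatrix id (Fin.castLE hk), ?_, ?_⟩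
  · ext i j
    have h := congrFun (congrFun hQ (Fin.castLE hk i)) (Fin.castLE hk j)
    simpa [Matrix.mul_apply, Matrix.one_apply] using h
  · have h1 : Qᵀ * (Xᵀ * X) = diagonal (fun i : Fin n => singularValue X i ^ 2) * Qᵀ := by
      rw [hX, Matrix.mul_assoc, ← Matrix.mul_assoc Qᵀ, hQ, Matrix.one_mul]
    ext i j
    have h := congrFun (congrFun h1 (Fin.castLE hk i)) j
    rw [diagonal_mul, Matrix.mul_apply] at h ⊢
    simpa using h

/-! ### Horn's inequality -/

/-- By symmetry this is an equality for `k ≤ min m n`, but one direction is enough for Horn's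
inequality. -/
theorem prod_singularValue_transpose_le {m n k : ℕ} (X : Matrix (Fin m) (Fin n) ℝ) (hk : k ≤ m) :
    ∏ i ∈ range k, singularValue Xᵀ i ≤ ∏ i ∈ range k, singularValue X i := by
  have h0 : ∀ {a b : ℕ} (Y : Matrix (Fin a) (Fin b) ℝ), 0 ≤ ∏ i ∈ range k, singularValue Y i :=
    fun Y => prod_nonneg fun i _ => singularValue_nonneg Y i
  obtain ⟨W, hW, hXW⟩ := exists_gram_mul_eq_diagonal Xᵀ hk
  rw [Matrix.transpose_transpose] at hXW
  have hdet : (diagonal (fun i : Fin k => singularValue Xᵀ i ^ 2)).det =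
      (∏ i ∈ range k, singularValue Xᵀ i) ^ 2 := by
    rw [det_diagonal, Fin.prod_univ_eq_prod_range (fun i => singularValue Xᵀ i ^ 2), prod_pow]
  have h1 : (Xᵀ * W)ᵀ * (Xᵀ * W) = diagonal (fun i : Fin k => singularValue Xᵀ i ^ 2) := by
    calc (Xᵀ * W)ᵀ * (Xᵀ * W) = Wᵀ * (X * Xᵀ) * W := by
          simp only [Matrix.transpose_mul, Matrix.transpose_transpose, Matrix.mul_assoc]
      _ = _ := by rw [hXW, Matrix.mul_assoc, hW, Matrix.mul_one]
  have h2 : (X * (Xᵀ * W))ᵀ * (X * (Xᵀ * W)) =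
      diagonal (fun i : Fin k => singularValue Xᵀ i ^ 2) *
        diagonal (fun i : Fin k => singularValue Xᵀ i ^ 2) := by
    have h3 : X * Xᵀ * W = W * diagonal (fun i : Fin k => singularValue Xᵀ i ^ 2) := by
      simpa using congrArg Matrix.transpose hXW
    rw [← Matrix.mul_assoc X, h3, Matrix.transpose_mul, diagonal_transpose, Matrix.mul_assoc,
      ← Matrix.mul_assoc Wᵀ, hW, Matrix.one_mul]
  -- with `P = ∏ σᵢ(Xᵀ)`, the determinant bound reads `P² P² ≤ (∏ σᵢ(X))² P²`
  have h := det_gram_mul_le X (Xᵀ * W)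
  rw [h1, h2, det_mul, hdet] at h
  rcases (h0 Xᵀ).eq_or_lt with h4 | h4
  · rw [← h4]; exact h0 X
  · exact le_of_sq_le_sq (le_of_mul_le_mul_right h (by positivity)) (h0 X)

/-- Horn's inequality for the singular values of a product. -/
theorem prod_singularValue_mul_le {m n d k : ℕ} (U : Matrix (Fin m) (Fin d) ℝ)
    (V : Matrix (Fin n) (Fin d) ℝ) (hk : k ≤ n) :
    ∏ i ∈ range k, singularValue (U * Vᵀ) i ≤
      ∏ i ∈ range k, singularValue U i * singularValue V i := by
  have h0 : ∀ {a b : ℕ} (Y : Matrix (Fin a) (Fin b) ℝ), 0 ≤ ∏ i ∈ range k, singularValue Y i :=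
    fun Y => prod_nonneg fun i _ => singularValue_nonneg Y i
  obtain ⟨W, hW, hXW⟩ := exists_gram_mul_eq_diagonal (U * Vᵀ) hk
  have h1 : ((U * (Vᵀ * W))ᵀ * (U * (Vᵀ * W))).det =
      (∏ i ∈ range k, singularValue (U * Vᵀ) i) ^ 2 := by
    have h2 : (U * (Vᵀ * W))ᵀ * (U * (Vᵀ * W)) = Wᵀ * ((U * Vᵀ)ᵀ * (U * Vᵀ)) * W := by
      simp only [Matrix.transpose_mul, Matrix.mul_assoc]
    rw [h2, hXW, Matrix.mul_assoc, hW, Matrix.mul_one, det_diagonal,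
      Fin.prod_univ_eq_prod_range (fun i => singularValue (U * Vᵀ) i ^ 2), prod_pow]
  have hU := det_gram_mul_le U (Vᵀ * W)
  have hV := det_gram_mul_le Vᵀ W
  rw [hW, det_one, mul_one] at hV
  rw [h1] at hU
  have h3 : (∏ i ∈ range k, singularValue (U * Vᵀ) i) ^ 2 ≤
      ((∏ i ∈ range k, singularValue U i) * ∏ i ∈ range k, singularValue Vᵀ i) ^ 2 := by
    rw [mul_pow]
    exact hU.trans (mul_le_mul_of_nonneg_left hV (sq_nonneg _))
  rw [prod_mul_distrib]
  exact (le_of_sq_le_sq h3 (mul_nonneg (h0 U) (h0 Vᵀ))).trans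
    (mul_le_mul_of_nonneg_left (prod_singularValue_transpose_le V hk) (h0 U))

/-! ### Schatten norms -/

theorem sum_singularValue_rpow_nonneg {m n : ℕ} (X : Matrix (Fin m) (Fin n) ℝ) (p : ℝ) :
    0 ≤ ∑ i ∈ range n, singularValue X i ^ p :=
  sum_nonneg fun i _ => Real.rpow_nonneg (singularValue_nonneg X i) p

theorem schattenNorm_nonneg {m n : ℕ} (p : ℝ) (X : Matrix (Fin m) (Fin n) ℝ) :
    0 ≤ schattenNorm p X :=
  Real.rpow_nonneg (sum_singularValue_rpow_nonneg X p) _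

theorem schattenNorm_rpow {m n : ℕ} {p : ℝ} (hp : p ≠ 0) (X : Matrix (Fin m) (Fin n) ℝ) :
    schattenNorm p X ^ p = ∑ i ∈ range n, singularValue X i ^ p := by
  rw [schattenNorm, ← Real.rpow_mul (sum_singularValue_rpow_nonneg X p), one_div_mul_cancel hp,
    Real.rpow_one]

/-- Hölder's inequality for Schatten (quasi-)norms. -/
theorem schattenNorm_mul_transpose_le {m n d : ℕ} (U : Matrix (Fin m) (Fin d) ℝ)
    (V : Matrix (Fin n) (Fin d) ℝ) {p p₁ p₂ : ℝ} (hp : 0 < p) (hp₁ : 0 < p₁) (hp₂ : 0 < p₂)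
    (hsum : 1 / p₁ + 1 / p₂ = 1 / p) :
    schattenNorm p (U * Vᵀ) ≤ schattenNorm p₁ U * schattenNorm p₂ V := by
  have h1 : ∑ i ∈ range n, singularValue (U * Vᵀ) i ^ p ≤
      (∑ i ∈ range d, singularValue U i ^ p₁) ^ (p / p₁) *
        (∑ i ∈ range d, singularValue V i ^ p₂) ^ (p / p₂) := by
    calc ∑ i ∈ range n, singularValue (U * Vᵀ) i ^ p
        ≤ ∑ i ∈ range n, (singularValue U i * singularValue V i) ^ p :=
          sum_rpow_le_sum_rpow_of_prod_le (singularValue_antitone _) (singularValue_nonneg _)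
            (fun i => mul_nonneg (singularValue_nonneg U i) (singularValue_nonneg V i)) hp
            fun k hk => prod_singularValue_mul_le U V hk
      _ ≤ ∑ i ∈ range (max n d), (singularValue U i * singularValue V i) ^ p :=
          sum_le_sum_of_subset_of_nonneg (range_subset_range.2 (le_max_left n d)) fun i _ _ =>
            Real.rpow_nonneg (mul_nonneg (singularValue_nonneg U i) (singularValue_nonneg V i)) p
      _ = ∑ i ∈ range d, (singularValue U i * singularValue V i) ^ p := by
          refine (sum_subset (range_subset_range.2 (le_max_right n d)) fun i _ hi => ?_).symm
          rw [singularValue_eq_zero_of_le U (by simpa using hi), zero_mul, Real.zero_rpow hp.ne']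
      _ ≤ _ := sum_mul_rpow_le (singularValue_nonneg U) (singularValue_nonneg V) hp hp₁ hp₂ hsum _
  have h2 := Real.rpow_le_rpow (sum_singularValue_rpow_nonneg _ p) h1 (one_div_pos.2 hp).le
  rw [Real.mul_rpow (Real.rpow_nonneg (sum_singularValue_rpow_nonneg U p₁) _)
    (Real.rpow_nonneg (sum_singularValue_rpow_nonneg V p₂) _),
    ← Real.rpow_mul (sum_singularValue_rpow_nonneg U p₁),
    ← Real.rpow_mul (sum_singularValue_rpow_nonneg V p₂)] at h2
  have h3 : ∀ q : ℝ, p / q * (1 / p) = 1 / q := fun q => by field_simp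
  rwa [h3, h3] at h2

/-- If the Gram matrix of `U` is diagonal, the singular values of `U` are the square roots of its
diagonal entries up to order, because both give the roots of the characteristic polynomial. -/
theorem schattenNorm_rpow_of_gram_eq_diagonal {m d : ℕ} {U : Matrix (Fin m) (Fin d) ℝ}
    {c : ℕ → ℝ} (hc : ∀ i, 0 ≤ c i)
    (hU : Uᵀ * U = diagonal (fun i : Fin d => c i ^ 2)) {p : ℝ} (hp : p ≠ 0) :
    schattenNorm p U ^ p = ∑ i ∈ range d, c i ^ p := by
  obtain ⟨Q, hQ, -, hX⟩ := exists_gram_eq_mul_diagonal_mul U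
  have hchar : (diagonal (fun i : Fin d => c i ^ 2)).charpoly =
      (diagonal (fun i : Fin d => singularValue U i ^ 2)).charpoly := by
    rw [← hU, hX, Matrix.mul_assoc, charpoly_mul_comm, Matrix.mul_assoc, hQ, Matrix.mul_one]
  have hroots := congrArg Polynomial.roots hchar
  have hprod : ∀ f : Fin d → ℝ, (∏ i, (Polynomial.X - Polynomial.C (f i))).roots =
      univ.val.map f := fun f => by
    have h := Polynomial.roots_multiset_prod_X_sub_C (univ.val.map f)
    rwa [Multiset.map_map] at h
  rw [charpoly_diagonal, charpoly_diagonal, hprod, hprod] at hroots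
  have hmap := congrArg (fun M => (M.map fun x : ℝ => √x ^ p).sum) hroots
  simp only [Multiset.map_map, Function.comp_def, Real.sqrt_sq (hc _),
    Real.sqrt_sq (singularValue_nonneg U _)] at hmap
  rw [schattenNorm_rpow hp, ← Fin.sum_univ_eq_sum_range (fun i => singularValue U i ^ p),
    ← Fin.sum_univ_eq_sum_range (fun i => c i ^ p)]
  exact hmap.symm

/-- A factorization `X = U Vᵀ` in which `U` has singular values `σᵢ ^ (p / p₁)` and `V` has singular
values `σᵢ ^ (p / p₂)`, where `σᵢ` are those of `X`. -/
theorem exists_balanced_factorization {m n d : ℕ} (X : Matrix (Fin m) (Fin n) ℝ)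
    (hX : X.rank ≤ d) {p p₁ p₂ : ℝ} (hp : 0 < p) (hp₁ : 0 < p₁) (hp₂ : 0 < p₂)
    (hsum : 1 / p₁ + 1 / p₂ = 1 / p) :
    ∃ (U : Matrix (Fin m) (Fin d) ℝ) (V : Matrix (Fin n) (Fin d) ℝ), X = U * Vᵀ ∧
      schattenNorm p₁ U ^ p₁ = schattenNorm p X ^ p ∧
      schattenNorm p₂ V ^ p₂ = schattenNorm p X ^ p := by
  have hsum' := div_add_div_eq_one_of_one_div_add hp hp₁ hp₂ hsum
  obtain ⟨Q, hQ, hQ', hXX⟩ := exists_gram_eq_mul_diagonal_mul X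
  set s := singularValue X with hs
  have hs0 : ∀ i, 0 ≤ s i := singularValue_nonneg X
  have hgram : (X * Q)ᵀ * (X * Q) = diagonal (fun i : Fin n => s i ^ 2) := by
    calc (X * Q)ᵀ * (X * Q) = Qᵀ * (Xᵀ * X) * Q := by
          simp only [Matrix.transpose_mul, Matrix.mul_assoc]
      _ = (Qᵀ * Q) * diagonal (fun i : Fin n => s i ^ 2) * (Qᵀ * Q) := by
          rw [hXX]; simp only [Matrix.mul_assoc]
      _ = _ := by rw [hQ, Matrix.one_mul, Matrix.mul_one]
  have hzero : ∀ (a : Fin m) (j : Fin n), s j = 0 → (X * Q) a j = 0 := by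
    intro a j hj
    have h := congrFun (congrFun hgram j) j
    rw [diagonal_apply_eq, hj, Matrix.mul_apply] at h
    have h' := (sum_eq_zero_iff_of_nonneg fun a _ => by
      simpa using mul_self_nonneg ((X * Q) a j)).1 (h.trans (by norm_num)) a (mem_univ a)
    simpa using h'
  -- `E` keeps the first `d` columns, padding with zero columns if `n < d`
  let E : Matrix (Fin n) (Fin d) ℝ := Matrix.of fun i j => if (i : ℕ) = j then 1 else 0
  have hE : ∀ g : ℕ → ℝ, (∀ i, n ≤ i → g i = 0) →
      Eᵀ * diagonal (fun i : Fin n => g i) * E = diagonal (fun i : Fin d => g i) := by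
    intro g hg
    ext i j
    rw [Matrix.mul_apply]
    simp only [mul_diagonal, transpose_apply, E, Matrix.of_apply, diagonal_apply]
    rw [Fin.sum_univ_eq_sum_range
      (fun l => (if l = (i : ℕ) then 1 else 0) * g l * (if l = (j : ℕ) then 1 else 0))]
    simp only [ite_mul, one_mul, zero_mul, sum_ite_eq', mem_range, Fin.val_inj, mul_ite, mul_one,
      mul_zero]
    have := hg i
    split_ifs <;> grind
  have hE' : ∀ g : ℕ → ℝ, (∀ i, d ≤ i → g i = 0) →
      E * Eᵀ * diagonal (fun i : Fin n => g i) = diagonal (fun i : Fin n => g i) := by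
    intro g hg
    ext i j
    rw [mul_diagonal, Matrix.mul_apply]
    simp only [transpose_apply, E, Matrix.of_apply, diagonal_apply]
    rw [Fin.sum_univ_eq_sum_range
      (fun l => (if (i : ℕ) = l then (1 : ℝ) else 0) * (if (j : ℕ) = l then 1 else 0))]
    simp only [ite_mul, one_mul, zero_mul, sum_ite_eq, mem_range, Fin.val_inj]
    have := hg j
    split_ifs <;> grind
  have hsn : ∀ i, n ≤ i → s i = 0 := fun i hi => singularValue_eq_zero_of_le X hi
  have hsd : ∀ i, d ≤ i → s i = 0 := fun i hi => singularValue_eq_zero_of_rank_le X (hX.trans hi)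
  have hsum_eq : ∑ i ∈ range d, s i ^ p = ∑ i ∈ range n, s i ^ p := by
    have h : ∀ a b : ℕ, (∀ i, a ≤ i → s i = 0) →
        ∑ i ∈ range a, s i ^ p = ∑ i ∈ range (max a b), s i ^ p := by
      intro a b hab
      refine sum_subset (range_subset_range.2 (le_max_left a b)) fun i _ hi => ?_
      rw [hab i (by simpa using hi), Real.zero_rpow hp.ne']
    rw [h d n hsd, h n d hsn, max_comm]
  -- a factor with singular values `s i ^ (p / q)` has the required Schatten norm
  have hnorm : ∀ {l : ℕ} (Y : Matrix (Fin l) (Fin d) ℝ) (q : ℝ), 0 < q →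
      Yᵀ * Y = Eᵀ * diagonal (fun i : Fin n => (s i ^ (p / q)) ^ 2) * E →
      schattenNorm q Y ^ q = schattenNorm p X ^ p := by
    intro l Y q hq hY
    rw [hE (fun i => (s i ^ (p / q)) ^ 2) fun i hi => by
      rw [hsn i hi, Real.zero_rpow (div_pos hp hq).ne', zero_pow two_ne_zero]] at hY
    rw [schattenNorm_rpow_of_gram_eq_diagonal (c := fun i => s i ^ (p / q))
      (fun i => Real.rpow_nonneg (hs0 i) _) hY hq.ne', schattenNorm_rpow hp.ne', ← hsum_eq]
    refine sum_congr rfl fun i _ => ?_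
    rw [← Real.rpow_mul (hs0 i), div_mul_cancel₀ p hq.ne']
  -- with `X = P Σ Qᵀ`, these give `U = P Σ ^ (p / p₁)` and `V = Q Σ ^ (p / p₂)`, resized to `d`
  -- columns; where `σᵢ = 0` the power in `D₁` is arbitrary, but column `i` of `X * Q` vanishes
  set D₁ : Matrix (Fin n) (Fin n) ℝ := diagonal fun i => s i ^ (p / p₁ - 1) with hD₁
  set D₂ : Matrix (Fin n) (Fin n) ℝ := diagonal fun i => s i ^ (p / p₂) with hD₂
  refine ⟨X * Q * D₁ * E, Q * D₂ * E, ?_, hnorm _ p₁ hp₁ ?_, hnorm _ p₂ hp₂ ?_⟩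
  · have h1 : E * Eᵀ * D₂ = D₂ := hE' (fun i => s i ^ (p / p₂)) fun i hi => by
      rw [hsd i hi, Real.zero_rpow (div_pos hp hp₂).ne']
    have h2 : X * Q * (D₁ * D₂) = X * Q := by
      rw [hD₁, hD₂, diagonal_mul_diagonal]
      ext a j
      rw [mul_diagonal]
      rcases (hs0 j).eq_or_lt with h0 | h0
      · rw [hzero a j h0.symm, zero_mul]
      · rw [← Real.rpow_add h0, show p / p₁ - 1 + p / p₂ = 0 by linarith, Real.rpow_zero, mul_one]
    calc X = X * Q * (D₁ * D₂) * Qᵀ := by rw [h2, Matrix.mul_assoc, hQ', Matrix.mul_one]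
      _ = X * Q * (D₁ * (E * Eᵀ * D₂)) * Qᵀ := by rw [h1]
      _ = _ := by
          simp only [Matrix.transpose_mul, hD₂, diagonal_transpose, Matrix.mul_assoc]
  · have h1 : D₁ * diagonal (fun i : Fin n => s i ^ 2) * D₁ =
        diagonal (fun i : Fin n => (s i ^ (p / p₁)) ^ 2) := by
      rw [hD₁, diagonal_mul_diagonal, diagonal_mul_diagonal]
      congr 1
      ext i
      rcases (hs0 i).eq_or_lt with h0 | h0
      · rw [← h0, Real.zero_rpow (div_pos hp hp₁).ne']
        ring
      · rw [Real.rpow_sub_one h0.ne']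
        field_simp
    calc (X * Q * D₁ * E)ᵀ * (X * Q * D₁ * E) = Eᵀ * (D₁ * ((X * Q)ᵀ * (X * Q)) * D₁) * E := by
          simp only [Matrix.transpose_mul, hD₁, diagonal_transpose, Matrix.mul_assoc]
      _ = _ := by rw [hgram, h1]
  · calc (Q * D₂ * E)ᵀ * (Q * D₂ * E) = Eᵀ * (D₂ * (Qᵀ * Q) * D₂) * E := by
          simp only [Matrix.transpose_mul, hD₂, diagonal_transpose, Matrix.mul_assoc]
      _ = _ := by
          rw [hQ, Matrix.mul_one, hD₂, diagonal_mul_diagonal]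
          simp only [sq]

theorem theorem3 (m n d : ℕ) (X : Matrix (Fin m) (Fin n) ℝ) (hX : X.rank ≤ d)
    (p p₁ p₂ : ℝ) (hp : 0 < p) (hp1 : p ≤ 1) (hp₁ : 0 < p₁) (hp₂ : 0 < p₂)
    (hsum : 1 / p₁ + 1 / p₂ = 1 / p) :
    IsLeast {t : ℝ | ∃ (U : Matrix (Fin m) (Fin d) ℝ) (V : Matrix (Fin n) (Fin d) ℝ),
        X = U * V.transpose ∧ t = schattenNorm p₁ U * schattenNorm p₂ V}
      (schattenNorm p X) ∧
    IsLeast {t : ℝ | ∃ (U : Matrix (Fin m) (Fin d) ℝ) (V : Matrix (Fin n) (Fin d) ℝ),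
        X = U * V.transpose ∧
        t = ((p₂ * schattenNorm p₁ U ^ p₁ + p₁ * schattenNorm p₂ V ^ p₂) / (p₁ + p₂)) ^ (1 / p)}
      (schattenNorm p X) ∧
    IsLeast {t : ℝ | ∃ (U : Matrix (Fin m) (Fin d) ℝ) (V : Matrix (Fin n) (Fin d) ℝ),
        X = U * V.transpose ∧
        t = ((schattenNorm p₁ U ^ p₁ / p₁ + schattenNorm p₂ V ^ p₂ / p₂) / (1 / p)) ^ (1 / p)}
      (schattenNorm p X) := by
  have hlower : ∀ (U : Matrix (Fin m) (Fin d) ℝ) (V : Matrix (Fin n) (Fin d) ℝ), X = U * Vᵀ →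
      schattenNorm p X ≤ schattenNorm p₁ U * schattenNorm p₂ V := by
    rintro U V rfl
    exact schattenNorm_mul_transpose_le U V hp hp₁ hp₂ hsum
  obtain ⟨U₀, V₀, hUV, hU₀, hV₀⟩ := exists_balanced_factorization X hX hp hp₁ hp₂ hsum
  have hp12 : p₁ + p₂ ≠ 0 := (add_pos hp₁ hp₂).ne'
  -- the two weighted means are the same, as `p₂ / (p₁ + p₂) = p / p₁` and `p₁ / (p₁ + p₂) = p / p₂`
  have hmean : ∀ x y : ℝ, (p₂ * x + p₁ * y) / (p₁ + p₂) = (x / p₁ + y / p₂) / (1 / p) := by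
    intro x y
    rw [← hsum]
    field_simp
    ring
  have hval : ((schattenNorm p₁ U₀ ^ p₁ / p₁ + schattenNorm p₂ V₀ ^ p₂ / p₂) / (1 / p)) ^ (1 / p) =
      schattenNorm p X := by
    rw [← hmean, hU₀, hV₀, ← add_mul, add_comm p₂ p₁, mul_div_cancel_left₀ _ hp12,
      ← Real.rpow_mul (schattenNorm_nonneg p X), mul_one_div_cancel hp.ne', Real.rpow_one]
  have hmul_le : ∀ (U : Matrix (Fin m) (Fin d) ℝ) (V : Matrix (Fin n) (Fin d) ℝ),
      schattenNorm p₁ U * schattenNorm p₂ V ≤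
        ((schattenNorm p₁ U ^ p₁ / p₁ + schattenNorm p₂ V ^ p₂ / p₂) / (1 / p)) ^ (1 / p) :=
    fun U V => mul_le_weighted_mean_rpow (schattenNorm_nonneg _ U) (schattenNorm_nonneg _ V)
      hp hp₁ hp₂ hsum
  simp only [hmean]
  have hthird : IsLeast {t : ℝ | ∃ (U : Matrix (Fin m) (Fin d) ℝ) (V : Matrix (Fin n) (Fin d) ℝ),
      X = U * Vᵀ ∧
      t = ((schattenNorm p₁ U ^ p₁ / p₁ + schattenNorm p₂ V ^ p₂ / p₂) / (1 / p)) ^ (1 / p)}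
      (schattenNorm p X) := by
    refine ⟨⟨U₀, V₀, hUV, hval.symm⟩, ?_⟩
    rintro _ ⟨U, V, h, rfl⟩
    exact (hlower U V h).trans (hmul_le U V)
  refine ⟨⟨⟨U₀, V₀, hUV, ?_⟩, ?_⟩, hthird, hthird⟩
  · exact (hlower U₀ V₀ hUV).antisymm ((hmul_le U₀ V₀).trans_eq hval)
  · rintro _ ⟨U, V, h, rfl⟩
    exact hlower U V h
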